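/- **Definitions.** Let $k,n,t,a$ be natural numbers; the database is $x\in\{0,1\}^n$, replicated over $k$ servers. *Classical PIR.* In a one-round $k$-server PIR scheme with query size $t$ and answer size $a$, the user, on input $i\in[n]$ and a random string $r$ (from a finite probability space), sends queries $q_1,\dots,q_k\in\{0,1\}^t$ to the respective servers. Server $j$ returns an answer $a_j\in\{0,1\}^a$ that depends only on $j$, $x$ and $q_j$. The user outputs a bit that depends on $i,r,a_1,\dots,a_k$. For all $x,i$ the output equals $x_i$ with probability $1$, and for each $j$ the distribution of $q_j$ does not depend on $i$. The communication is $k(t+a)$ bits. The scheme is *XOR-linear* if the output is $\sum_{j=1}^k a_j\cdot b_j \bmod 2$ for strings $b_1,\dots,b_k\in\{0,1\}^a$ determined by $i$ and $r$. *Honest-user QSPIR without shared randomness.* In a one-round $k$-server quantum scheme with query size $t$ and answer size $a$, the user, on input $i$, draws a random string $r$ (which he keeps), prepares a pure state, depending on $i$ and $r$, of a private memory and $k$ registers of $t$ qubits each, and sends the $j$-th register to server $j$. Each server, independently of the others and without any state shared with them beforehand, applies a quantum operation that depends on $x$ (an isometry into an answer register of $a$ qubits and a memory that he keeps) and sends back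 the answer register. The user applies a unitary depending on $i$ and $r$ and measures an output bit. The communication is $k(t+a)$ qubits. The following are required. * Recovery: for all $x$ and $i$ the output equals $x_i$ with probability $1$. * User privacy: the density matrix of each individual server, at every point of the protocol, does not depend on $i$. * Data privacy: when the user follows the protocol, the list of his density matrices (including the register holding $r$) at the various points of the protocol does not depend on the bits $x_j$, $j\ne i$. * No shared randomness: the servers start without shared randomness or entanglement, and the joint state of the memories they keep at the end is a product state. **Theorem.** 1. For all $k,n,t,a$: if there is an XOR-linear one-round $k$-server PIR scheme for $n$-bit databases with query size $t$ and answer size $a$, then there is an honest-user $k$-server QSPIR scheme without shared randomness for $n$-bit databases, with queries and answers of $t+a$ qubits each; so its communication, $2k(t+a)$ qubits, is exactly twice that of the classical scheme. 2. There is a function $e:\mathbb N\to\mathbb R$ with $$e(k)=O\!\left(\frac{\log\log k}{k\log k}\right)\qquad (k\to\infty)$$ such that for every $k\ge 2$ we have $e(k)<1$, and there is a constant $C_k$ such that for every $n\ge 1$ there is an honest-user $k$-server QSPIR scheme without shared randomness for $n$-bit databases whose communication is at most $C_k\, n^{e(k)}$ qubits. -/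

import Mathlib

open Matrix Finset

/-- Bit strings of length `m`, with addition modulo 2.  They also label the computational basis
of a register of `m` qubits. -/
abbrev Bits (m : ℕ) : Type := Fin m → ZMod 2

/-! ### Classical private information retrieval -/

/-- The parties of a one-round classical protocol with `k` servers and a database of `n` bits,
with queries of `t` bits and answers of `a` bits.  The user is a randomized algorithm with a
finite random string in `R`; the servers are deterministic. -/
structure PIRScheme (k n t a : ℕ) where
  R : Type
  [fintypeR : Fintype R]
  prob : R → ℝ
  prob_nonneg : ∀ r, 0 ≤ prob r
  prob_sum : ∑ r, prob r = 1
  /-- the query to server `j` -/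
  query : Fin n → R → Fin k → Bits t
  /-- the answer of server `j` on database `x` to a query -/
  answer : Fin k → Bits n → Bits t → Bits a
  /-- the output of the user -/
  output : Fin n → R → (Fin k → Bits a) → ZMod 2

namespace PIRScheme

variable {k n t a : ℕ} (P : PIRScheme k n t a)

attribute [instance] PIRScheme.fintypeR

/-- The answers that the user receives. -/
def answers (i : Fin n) (x : Bits n) (r : P.R) : Fin k → Bits a :=
  fun j => P.answer j x (P.query i r j)

/-- Probability that the user's output is `x i`. -/
noncomputable def successProb (i : Fin n) (x : Bits n) : ℝ :=
  ∑ r, if P.output i r (P.answers i x r) = x i then P.prob r else 0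

/-- Distribution of the query received by server `j`. -/
noncomputable def queryDist (i : Fin n) (j : Fin k) (q : Bits t) : ℝ :=
  ∑ r, if P.query i r j = q then P.prob r else 0

/-- A private information retrieval scheme with recovery probability 1. -/
structure IsPIR : Prop where
  recovery : ∀ i x, P.successProb i x = 1
  user_privacy : ∀ (j : Fin k) (i i' : Fin n), P.queryDist i j = P.queryDist i' j

/-- The user outputs `∑ⱼ aⱼ · bⱼ` modulo 2, with `b₁, …, bₖ` determined by the index and the
user's random string. -/
def IsXORLinear : Prop :=
  ∃ b : Fin n → P.R → Fin k → Bits a,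
    ∀ i r (ans : Fin k → Bits a), P.output i r ans = ∑ j, ans j ⬝ᵥ b i r j

/-- Total number of bits communicated. -/
def communication (_P : PIRScheme k n t a) : ℕ := k * (t + a)

end PIRScheme

/-! ### Density matrices -/

/-- The density matrix of a pure state. -/
def pureDensity {α : Type} (ψ : α → ℂ) : Matrix α α ℂ := vecMulVec ψ (star ψ)

/-- Partial trace over the second tensor factor. -/
def traceRight {α β : Type} [Fintype β] (ρ : Matrix (α × β) (α × β) ℂ) : Matrix α α ℂ :=
  fun a a' => ∑ b, ρ (a, b) (a', b)

/-- Partial trace over the first tensor factor. -/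
def traceLeft {α β : Type} [Fintype α] (ρ : Matrix (α × β) (α × β) ℂ) : Matrix β β ℂ :=
  fun b b' => ∑ a, ρ (a, b) (a, b')

/-- Reduced density matrix of the `j`-th of `k` registers (all the others are traced out). -/
def marginal {k : ℕ} {X : Fin k → Type} [∀ j, Fintype (X j)] [∀ j, DecidableEq (X j)]
    (ρ : Matrix (∀ j, X j) (∀ j, X j) ℂ) (j : Fin k) : Matrix (X j) (X j) ℂ :=
  fun a b => ∑ z : (∀ j, X j), if z j = a then ρ z (Function.update z j b) else 0

/-! ### Quantum protocols -/

/-- The parties of a one-round quantum protocol with `k` servers and a database of `n` bits, with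
queries of `t` qubits and answers of `a` qubits.

* The honest user draws a random string `r`, which he keeps.  Given `i` and `r` he prepares a pure
  state of his own memory `U` and `k` query registers, and sends the `j`-th register to server `j`.
* Server `j`, on database `x`, applies an isometry from the query register to an answer register
  and a private memory `W j` (this is a unitary on the query and fresh private workspace, so it
  covers every quantum operation, and private randomness as well).  He sends back the answer
  register and keeps `W j`.  The servers act independently, and share no state beforehand.
* The user applies a unitary, which may depend on `i` and `r`, to his memory and the answers, and
  measures one bit, a function of the computational basis state. -/
structure QScheme (k n t a : ℕ) where
  R : Type
  U : Type
  W : Fin k → Type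
  [fintypeR : Fintype R]
  [decEqR : DecidableEq R]
  [fintypeU : Fintype U]
  [decEqU : DecidableEq U]
  [fintypeW : ∀ j, Fintype (W j)]
  [decEqW : ∀ j, DecidableEq (W j)]
  prob : R → ℝ
  prob_nonneg : ∀ r, 0 ≤ prob r
  prob_sum : ∑ r, prob r = 1
  prepare : Fin n → R → U × (Fin k → Bits t) → ℂ
  prepare_norm : ∀ i r, ∑ z, ‖prepare i r z‖ ^ 2 = 1
  serverOp : Bits n → (j : Fin k) → Matrix (Bits a × W j) (Bits t) ℂ
  serverOp_isometry : ∀ x j, (serverOp x j)ᴴ * serverOp x j = 1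
  decode : Fin n → R → Matrix.unitaryGroup (U × (Fin k → Bits a)) ℂ
  outcome : U × (Fin k → Bits a) → ZMod 2

namespace QScheme

variable {k n t a : ℕ} (S : QScheme k n t a)

attribute [instance] QScheme.fintypeR QScheme.decEqR QScheme.fintypeU QScheme.decEqU
  QScheme.fintypeW QScheme.decEqW

/-- The registers that the user holds when he has received the answers. -/
abbrev UserReg : Type := S.U × (Fin k → Bits a)

/-- Average of an ensemble over the user's random string, for parties that do not see it. -/
noncomputable def average {α : Type} (ρ : S.R → Matrix α α ℂ) : Matrix α α ℂ :=
  ∑ r, (S.prob r : ℂ) • ρ r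

/-- The user's density matrix, with his random string as a classical register:
`∑ᵣ p(r) ρᵣ ⊗ |r⟩⟨r|`. -/
noncomputable def withCoins {α : Type} (ρ : S.R → Matrix α α ℂ) :
    Matrix (α × S.R) (α × S.R) ℂ :=
  blockDiagonal fun r => (S.prob r : ℂ) • ρ r

/-- The global state after the servers' operations, given the user's random string: the tensor
product of the servers' isometries applied to the prepared state. -/
noncomputable def evolved (i : Fin n) (x : Bits n) (r : S.R) :
    S.UserReg × (∀ j, S.W j) → ℂ :=
  fun z => ∑ q : Fin k → Bits t,
    (∏ j, S.serverOp x j (z.1.2 j, z.2 j) (q j)) * S.prepare i r (z.1.1, q)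

/-! #### The states of the user -/

/-- The state prepared by the user. -/
noncomputable def userPrepared (i : Fin n) (r : S.R) :
    Matrix (S.U × (Fin k → Bits t)) (S.U × (Fin k → Bits t)) ℂ :=
  pureDensity (S.prepare i r)

/-- The state of the user after sending the queries. -/
noncomputable def userKept (i : Fin n) (r : S.R) : Matrix S.U S.U ℂ :=
  traceRight (S.userPrepared i r)

/-- The state of the user after receiving the answers. -/
noncomputable def userReceived (i : Fin n) (x : Bits n) (r : S.R) :
    Matrix S.UserReg S.UserReg ℂ :=
  traceRight (pureDensity (S.evolved i x r))

/-- The state of the user after his final unitary. -/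
noncomputable def userDecoded (i : Fin n) (x : Bits n) (r : S.R) :
    Matrix S.UserReg S.UserReg ℂ :=
  (S.decode i r : Matrix S.UserReg S.UserReg ℂ) * S.userReceived i x r *
    (S.decode i r : Matrix S.UserReg S.UserReg ℂ)ᴴ

/-- The state of the user after the measurement of the output bit. -/
noncomputable def userMeasured (i : Fin n) (x : Bits n) (r : S.R) :
    Matrix S.UserReg S.UserReg ℂ :=
  fun z z' => if S.outcome z = S.outcome z' then S.userDecoded i x r z z' else 0

/-- Probability that the user's output is `x i`. -/
noncomputable def successProb (i : Fin n) (x : Bits n) : ℝ :=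
  ∑ r, S.prob r * ∑ z, if S.outcome z = x i then (S.userDecoded i x r z z).re else 0

/-- The view of the honest user: the list of his density matrices at the various points of the
protocol. -/
noncomputable def userView (i : Fin n) (x : Bits n) :=
  (S.withCoins fun r => S.userPrepared i r,
   S.withCoins fun r => S.userKept i r,
   S.withCoins fun r => S.userReceived i x r,
   S.withCoins fun r => S.userDecoded i x r,
   S.withCoins fun r => S.userMeasured i x r)

/-! #### The states of the servers -/

/-- The state of server `j` after receiving his query. -/
noncomputable def serverReceived (i : Fin n) (j : Fin k) : Matrix (Bits t) (Bits t) ℂ :=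
  marginal (X := fun _ => Bits t) (traceLeft (S.average fun r => S.userPrepared i r)) j

/-- The state of server `j` after his operation. -/
noncomputable def serverAnswered (i : Fin n) (x : Bits n) (j : Fin k) :
    Matrix (Bits a × S.W j) (Bits a × S.W j) ℂ :=
  S.serverOp x j * S.serverReceived i j * (S.serverOp x j)ᴴ

/-- The state of server `j` after sending back the answer. -/
noncomputable def serverFinal (i : Fin n) (x : Bits n) (j : Fin k) :
    Matrix (S.W j) (S.W j) ℂ :=
  traceLeft (S.serverAnswered i x j)

/-- The density matrices of server `j` at the various points of the protocol. -/
noncomputable def serverView (i : Fin n) (x : Bits n) (j : Fin k) :=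
  (S.serverReceived i j, S.serverAnswered i x j, S.serverFinal i x j)

/-- The joint state of the memories of all servers at the end of the protocol. -/
noncomputable def serversJointFinal (i : Fin n) (x : Bits n) :
    Matrix (∀ j, S.W j) (∀ j, S.W j) ℂ :=
  traceLeft (S.average fun r => pureDensity (S.evolved i x r))

/-! #### Requirements -/

/-- The servers end the protocol without any shared randomness or entanglement: their joint final
state is the product of their individual states.  (They start without any by the definition of a
protocol.) -/
def NoSharedRandomness : Prop :=
  ∀ i x (w w' : ∀ j, S.W j),
    S.serversJointFinal i x w w' = ∏ j, S.serverFinal i x j (w j) (w' j)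

/-- An honest-user quantum symmetrically-private information retrieval scheme with recovery
probability 1, without shared randomness among the servers. -/
structure IsHonestUserQSPIR : Prop where
  recovery : ∀ i x, S.successProb i x = 1
  user_privacy : ∀ (x : Bits n) (j : Fin k) (i i' : Fin n),
    S.serverView i x j = S.serverView i' x j
  data_privacy : ∀ (i : Fin n) (x x' : Bits n), x i = x' i → S.userView i x = S.userView i x'
  no_shared_randomness : S.NoSharedRandomness

/-- Total number of qubits communicated. -/
def communication (_S : QScheme k n t a) : ℕ := k * (t + a)

end QScheme

/-! ### Signs -/

/-! The quantum scheme rests on phase kickback with random masks. Besides the classical randomness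
the user draws uniform masks `c_j`, and prepares an equal superposition, labelled by a qubit `u`
that he keeps, of the strings `(q_j, c_j + u b_j)`. Each server multiplies by the sign of `a_j ·
(c_j + u b_j)` and returns the register. The signs multiply to a global sign `(-1)^(∑ a_j · c_j)`
times `(-1)^(u x_i)`. Undoing the shift and applying a Hadamard gate therefore yields `x_i`, while
the global sign, the only other dependence on `x`, cancels in the density matrix. A server, who does
not hold `u`, sees a classical query with a uniform mask, and keeps no memory. This is
`isHonestUserQSPIR_toQScheme`.

For the exponent, fifteen servers already achieve every positive power of `n`, through matching
vectors modulo 15. By Lucas' theorem, `1 + 5 C(s, 3^m - 1) + 9 C(s, 5^m - 1)` vanishes modulo 15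
exactly when `15^m` divides `s + 1`. With `s` the size of the intersection of the graphs of two
functions on `15^m - 1` points, this becomes an inner product that vanishes only if the functions
coincide. Its dimension is about `n^(5^m / (15^m - 1))`, and this exponent tends to 0 with growing
`m`. Hence for `k ≥ 15` the asymptotic bound itself can be taken as `e(k)`, the constant `C_k`
absorbing the choice of `m`. For smaller `k` a two-server square scheme gives exponent `1/2`. -/

/-- The sign `(-1) ^ s` of a bit. -/
def bitSign (s : ZMod 2) : ℂ := if s = 0 then 1 else -1

theorem bitSign_zero : bitSign 0 = 1 := rfl

theorem bitSign_add (s s' : ZMod 2) : bitSign (s + s') = bitSign s * bitSign s' := by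
  have h : ∀ v : ZMod 2, v = 0 ∨ v = 1 := by decide
  have h2 : (1 : ZMod 2) + 1 = 0 := rfl
  rcases h s with rfl | rfl <;> rcases h s' with rfl | rfl <;> simp [bitSign, h2]

theorem bitSign_mul_self (s : ZMod 2) : bitSign s * bitSign s = 1 := by
  rw [← bitSign_add, CharTwo.add_self_eq_zero, bitSign_zero]

theorem star_bitSign (s : ZMod 2) : star (bitSign s) = bitSign s := by
  unfold bitSign; split_ifs <;> simp

theorem bitSign_sum {ι : Type} (s : Finset ι) (f : ι → ZMod 2) :
    bitSign (∑ j ∈ s, f j) = ∏ j ∈ s, bitSign (f j) := by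
  classical
  induction s using Finset.induction_on with
  | empty => rfl
  | insert j s hj ih => rw [sum_insert hj, prod_insert hj, bitSign_add, ih]

/-- The amplitude of a balanced superposition of two basis states. -/
noncomputable def halfAmp : ℂ := ((Real.sqrt 2)⁻¹ : ℝ)

theorem halfAmp_mul_self : halfAmp * halfAmp = 1 / 2 := by
  rw [halfAmp, ← Complex.ofReal_mul, ← mul_inv, Real.mul_self_sqrt (by norm_num)]
  norm_num

theorem star_halfAmp : star halfAmp = halfAmp := Complex.conj_ofReal _

theorem sum_bits {M : Type} [AddCommMonoid M] (f : ZMod 2 → M) : ∑ u, f u = f 0 + f 1 :=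
  Fin.sum_univ_two f

/-! ### The user's final unitary -/

section decoder

variable {Z : Type} [Fintype Z] [DecidableEq Z] [AddCommGroup Z]

/-- A shift of the second register by `δ`, controlled by the first one, followed by a Hadamard
gate on the first register. -/
noncomputable def shiftHadamard (δ : Z) : Matrix (ZMod 2 × Z) (ZMod 2 × Z) ℂ :=
  fun y z => if z.2 = y.2 + z.1.val • δ then halfAmp * bitSign (y.1 * z.1) else 0

theorem shiftHadamard_mem_unitaryGroup (δ : Z) :
    shiftHadamard δ ∈ unitaryGroup (ZMod 2 × Z) ℂ := by
  rw [mem_unitaryGroup_iff]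
  ext ⟨v, y⟩ ⟨v', y'⟩
  simp only [star_eq_conjTranspose, mul_apply, conjTranspose_apply, shiftHadamard,
    Fintype.sum_prod_type, apply_ite star, star_zero, star_mul', star_halfAmp, star_bitSign,
    ite_mul, mul_ite, zero_mul, mul_zero, Finset.sum_ite_eq', mem_univ, if_true, add_left_inj]
  rw [sum_bits]
  by_cases h : y = y'
  · subst h
    have h2 : (halfAmp * halfAmp) = 1 / 2 := halfAmp_mul_self
    simp only [if_true, mul_zero, mul_one, bitSign_zero]
    by_cases hv : v = v'
    · subst hv
      have h3 := bitSign_mul_self v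
      rw [one_apply_eq]
      linear_combination (1 + bitSign v * bitSign v) * h2 + h3 / 2
    · have h3 : bitSign v * bitSign v' = -1 := by
        have h4 : ∀ s s' : ZMod 2, s ≠ s' → s + s' ≠ 0 := by decide
        rw [← bitSign_add, bitSign, if_neg (h4 v v' hv)]
      rw [one_apply_ne (by simpa using hv)]
      linear_combination (1 + bitSign v * bitSign v') * h2 + h3 / 2
  · rw [one_apply_ne (by simp [h])]
    simp [Ne.symm h]

/-- Shift and Hadamard recover the relative sign of a balanced superposition. -/
theorem shiftHadamard_mulVec (z δ : Z) (g s : ZMod 2) (ψ : ZMod 2 × Z → ℂ)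
    (hψ : ∀ u y, ψ (u, y) = if y = z + u.val • δ then
      bitSign g * bitSign (u * s) * halfAmp else 0) :
    shiftHadamard δ *ᵥ ψ = Pi.single (s, z) (bitSign g) := by
  ext ⟨v, y⟩
  simp only [mulVec, dotProduct, shiftHadamard, Fintype.sum_prod_type, ite_mul, zero_mul,
    Finset.sum_ite_eq', mem_univ, if_true, hψ, add_left_inj, mul_ite, mul_zero]
  -- Once the shift is undone both branches sit at `z`, and the Hadamard gate adds the two
  -- amplitudes: they reinforce at `v = s` and cancel otherwise.
  rw [sum_bits]
  have h2 : (halfAmp * halfAmp) = 1 / 2 := halfAmp_mul_self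
  by_cases h : y = z
  · subst h
    simp only [if_true, mul_zero, zero_mul, mul_one, one_mul, bitSign_zero]
    by_cases hv : v = s
    · subst hv
      have h3 := bitSign_mul_self v
      rw [Pi.single_eq_same]
      linear_combination (bitSign g * (1 + bitSign v * bitSign v)) * h2 + bitSign g / 2 * h3
    · have h3 : bitSign v * bitSign s = -1 := by
        have h4 : ∀ s s' : ZMod 2, s ≠ s' → s + s' ≠ 0 := by decide
        rw [← bitSign_add, bitSign, if_neg (h4 v s hv)]
      rw [Pi.single_eq_of_ne (by simpa using hv)]
      linear_combination (bitSign g * (1 + bitSign v * bitSign s)) * h2 + bitSign g / 2 * h3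
  · rw [Pi.single_eq_of_ne (by simp [h])]
    simp [Ne.symm h]

end decoder

/-! ### Pure states, diagonal phases and traces of reduced states. -/

theorem pureDensity_mulVec {α β : Type} [Fintype α] (M : Matrix β α ℂ) (ψ : α → ℂ) :
    pureDensity (M *ᵥ ψ) = M * pureDensity ψ * Mᴴ := by
  rw [pureDensity, pureDensity, mul_vecMulVec, vecMulVec_mul, star_mulVec]

/-- The diagonal operation that multiplies the basis state `q` by `(-1) ^ f q`. -/
def phaseOp {Z : Type} [DecidableEq Z] (f : Z → ZMod 2) : Matrix (Z × Unit) Z ℂ :=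
  fun y q => if y.1 = q then bitSign (f q) else 0

theorem phaseOp_isometry {Z : Type} [Fintype Z] [DecidableEq Z] (f : Z → ZMod 2) :
    (phaseOp f)ᴴ * phaseOp f = 1 := by
  ext y y'
  simp only [mul_apply, conjTranspose_apply, phaseOp, apply_ite star, star_zero, star_bitSign,
    Fintype.sum_prod_type, univ_unique, sum_singleton, ite_mul, zero_mul, mul_ite, mul_zero,
    Finset.sum_ite_eq', mem_univ, if_true]
  by_cases h : y = y'
  · rw [h, if_pos rfl, bitSign_mul_self, one_apply_eq]
  · rw [if_neg (Ne.symm h), one_apply_ne h]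

theorem trace_traceLeft {α β : Type} [Fintype α] [Fintype β] (ρ : Matrix (α × β) (α × β) ℂ) :
    (traceLeft ρ).trace = ρ.trace := by
  simp only [trace, diag_apply, traceLeft, Fintype.sum_prod_type]
  exact sum_comm

theorem trace_marginal {k : ℕ} {X : Fin k → Type} [∀ j, Fintype (X j)] [∀ j, DecidableEq (X j)]
    (ρ : Matrix (∀ j, X j) (∀ j, X j) ℂ) (j : Fin k) : (marginal ρ j).trace = ρ.trace := by
  simp only [trace, diag_apply, marginal]
  rw [sum_comm]
  refine sum_congr rfl fun z _ => ?_
  rw [Finset.sum_ite_eq, if_pos (mem_univ _), Function.update_eq_self]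

theorem trace_pureDensity {α : Type} [Fintype α] (ψ : α → ℂ) :
    (pureDensity ψ).trace = ((∑ z, ‖ψ z‖ ^ 2 : ℝ) : ℂ) := by
  simp only [trace, diag_apply, pureDensity, vecMulVec_apply, Pi.star_apply, Complex.ofReal_sum]
  refine sum_congr rfl fun z _ => ?_
  rw [Complex.ofReal_pow, ← Complex.mul_conj', starRingEnd_apply]

namespace QScheme

variable {k n t a : ℕ} (S : QScheme k n t a)

theorem trace_average {α : Type} [Fintype α] (ρ : S.R → Matrix α α ℂ)
    (h : ∀ r, (ρ r).trace = 1) : (S.average ρ).trace = 1 := by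
  rw [average, trace_sum]
  simp only [trace_smul, h, smul_eq_mul, mul_one]
  rw [← Complex.ofReal_sum, S.prob_sum, Complex.ofReal_one]

theorem trace_serverFinal (i : Fin n) (x : Bits n) (j : Fin k) :
    (S.serverFinal i x j).trace = 1 := by
  rw [serverFinal, trace_traceLeft, serverAnswered, trace_mul_cycle, S.serverOp_isometry, one_mul,
    serverReceived, trace_marginal, trace_traceLeft]
  refine S.trace_average _ fun r => ?_
  rw [userPrepared, trace_pureDensity, S.prepare_norm, Complex.ofReal_one]

end QScheme

/-! ### Strings of queries and masks -/

theorem bits_append_add {t a : ℕ} (q q' : Bits t) (c c' : Bits a) :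
    (Fin.append q c + Fin.append q' c' : Bits (t + a)) = Fin.append (q + q') (c + c') := by
  funext m
  refine Fin.addCases (fun m => ?_) (fun m => ?_) m <;> simp

theorem bits_append_eq_iff {t a : ℕ} (q : Bits t) (c : Bits a) (y : Bits (t + a)) :
    Fin.append q c = y ↔ q = (fun m => y (Fin.castAdd a m)) ∧ c = fun m => y (Fin.natAdd t m) := by
  constructor
  · rintro rfl
    simp
  · rintro ⟨rfl, rfl⟩
    exact Fin.append_castAdd_natAdd

/-! ### The quantum scheme -/

namespace PIRScheme

variable {k n t a : ℕ} (P : PIRScheme k n t a)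

/-- The basis state sent to the servers in the branch `u` of the superposition: the classical
queries, each followed by the mask, to which `b` is added if `u = 1`. -/
def maskedQuery (b : Fin n → P.R → Fin k → Bits a) (i : Fin n) (r : P.R × (Fin k → Bits a))
    (u : ZMod 2) : Fin k → Bits (t + a) :=
  fun j => Fin.append (P.query i r.1 j) (r.2 j + u • b i r.1 j)

/-- The difference of the two branches. -/
def branchShift (b : Fin n → P.R → Fin k → Bits a) (i : Fin n) (r : P.R × (Fin k → Bits a)) :
    Fin k → Bits (t + a) :=
  fun j => Fin.append 0 (b i r.1 j)

/-- The inner product of the answer with the second part of the string received. -/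
def answerParity (x : Bits n) (j : Fin k) (y : Bits (t + a)) : ZMod 2 :=
  P.answer j x (fun m => y (Fin.castAdd a m)) ⬝ᵥ fun m => y (Fin.natAdd t m)

theorem maskedQuery_eq (b : Fin n → P.R → Fin k → Bits a) (i : Fin n)
    (r : P.R × (Fin k → Bits a)) (u : ZMod 2) :
    P.maskedQuery b i r u = P.maskedQuery b i r 0 + u.val • P.branchShift b i r := by
  funext j
  have h : ∀ v : Bits (t + a), (u.val • v : Bits (t + a)) = u • v := by
    intro v
    rw [← Nat.cast_smul_eq_nsmul (ZMod 2), ZMod.natCast_zmod_val]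
  have h2 : (u • Fin.append (0 : Bits t) (b i r.1 j) : Bits (t + a)) =
      Fin.append (0 : Bits t) (u • b i r.1 j) := by
    funext m
    refine Fin.addCases (fun m => ?_) (fun m => ?_) m <;> simp
  rw [Pi.add_apply, Pi.smul_apply, h, maskedQuery, maskedQuery, branchShift, h2, bits_append_add]
  simp

/-- Linearity in the mask separates the phase into a part common to both branches and a part
proportional to `u`, whose sum over the servers is the classical output. -/
theorem answerParity_maskedQuery (b : Fin n → P.R → Fin k → Bits a) (i : Fin n)
    (r : P.R × (Fin k → Bits a)) (u : ZMod 2) (x : Bits n) (j : Fin k) :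
    P.answerParity x j (P.maskedQuery b i r u j) =
      P.answers i x r.1 j ⬝ᵥ r.2 j + u * (P.answers i x r.1 j ⬝ᵥ b i r.1 j) := by
  simp only [answerParity, maskedQuery, answers, Fin.append_left, Fin.append_right]
  rw [← smul_eq_mul, ← dotProduct_smul, ← dotProduct_add]

/-- The quantum scheme obtained from an XOR-linear scheme. -/
@[reducible] noncomputable def toQScheme (b : Fin n → P.R → Fin k → Bits a) : QScheme k n (t + a) (t + a) :=
  letI : DecidableEq P.R := Classical.decEq _
  { R := P.R × (Fin k → Bits a)
    U := ZMod 2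
    W := fun _ => Unit
    prob := fun r => P.prob r.1 * (Fintype.card (Fin k → Bits a) : ℝ)⁻¹
    prob_nonneg := fun r => mul_nonneg (P.prob_nonneg _) (by positivity)
    prob_sum := by
      have h : (Fintype.card (Fin k → Bits a) : ℝ) ≠ 0 := by exact_mod_cast Fintype.card_ne_zero
      rw [Fintype.sum_prod_type]
      simp only [sum_const, card_univ, nsmul_eq_mul]
      rw [← P.prob_sum]
      exact sum_congr rfl fun r _ => by field_simp
    prepare := fun i r z => if z.2 = P.maskedQuery b i r z.1 then halfAmp else 0
    prepare_norm := fun i r => by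
      have h : ‖halfAmp‖ ^ 2 = 1 / 2 := by
        rw [sq, ← norm_mul, halfAmp_mul_self]
        norm_num
      rw [Fintype.sum_prod_type, sum_bits]
      simp only [apply_ite norm, norm_zero, ite_pow, h, ne_eq, OfNat.ofNat_ne_zero,
        not_false_eq_true, zero_pow, Finset.sum_ite_eq', mem_univ, if_true]
      norm_num
    serverOp := fun x j => phaseOp (P.answerParity x j)
    serverOp_isometry := fun x j => phaseOp_isometry _
    decode := fun i r => ⟨shiftHadamard (P.branchShift b i r), shiftHadamard_mem_unitaryGroup _⟩
    outcome := fun z => z.1 }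

variable {b : Fin n → P.R → Fin k → Bits a}

theorem evolved_toQScheme (i : Fin n) (x : Bits n) (r : P.R × (Fin k → Bits a)) (u : ZMod 2)
    (y : Fin k → Bits (t + a)) (w : Fin k → Unit) :
    (P.toQScheme b).evolved i x r ((u, y), w) =
      if y = P.maskedQuery b i r 0 + u.val • P.branchShift b i r then
        bitSign (∑ j, P.answers i x r.1 j ⬝ᵥ r.2 j) *
          bitSign (u * ∑ j, P.answers i x r.1 j ⬝ᵥ b i r.1 j) * halfAmp
      else 0 := by
  rw [← maskedQuery_eq]
  have h1 : (P.toQScheme b).evolved i x r ((u, y), w) =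
      ∑ q : Fin k → Bits (t + a),
        (∏ j, if y j = q j then bitSign (P.answerParity x j (q j)) else 0) *
          if q = P.maskedQuery b i r u then halfAmp else 0 := rfl
  rw [h1]
  simp only [mul_ite, mul_zero, Finset.sum_ite_eq', mem_univ, if_true]
  split_ifs with h
  · subst h
    simp only [if_true, answerParity_maskedQuery]
    rw [← bitSign_sum, sum_add_distrib, ← mul_sum, bitSign_add]
  -- The operations are diagonal, so a basis state that differs from the query at one server has
  -- amplitude zero.
  · obtain ⟨j, hj⟩ := Function.ne_iff.1 h
    rw [Finset.prod_eq_zero (mem_univ j) (if_neg hj), zero_mul]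

theorem userReceived_toQScheme (i : Fin n) (x : Bits n) (r : P.R × (Fin k → Bits a)) :
    (P.toQScheme b).userReceived i x r =
      pureDensity fun z => (P.toQScheme b).evolved i x r (z, fun _ => ()) := by
  ext z z'
  exact Fintype.sum_unique (ι := ∀ _ : Fin k, Unit) _

/-- This is data privacy for fixed coins: the sign involving the masks is common to both branches,
so it meets itself in every entry of the density matrix and squares to 1. -/
theorem userReceived_toQScheme_eq (i : Fin n) (x x' : Bits n) (r : P.R × (Fin k → Bits a))
    (h : ∑ j, P.answers i x r.1 j ⬝ᵥ b i r.1 j = ∑ j, P.answers i x' r.1 j ⬝ᵥ b i r.1 j) :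
    (P.toQScheme b).userReceived i x r = (P.toQScheme b).userReceived i x' r := by
  rw [userReceived_toQScheme, userReceived_toQScheme]
  ext ⟨u, y⟩ ⟨u', y'⟩
  simp only [pureDensity, vecMulVec_apply, Pi.star_apply]
  rw [evolved_toQScheme, evolved_toQScheme, evolved_toQScheme, evolved_toQScheme, h]
  simp only [apply_ite star, star_zero, star_mul', star_bitSign, star_halfAmp]
  split_ifs with h1 h2
  · have e := bitSign_mul_self (∑ j, P.answers i x r.1 j ⬝ᵥ r.2 j)
    have e' := bitSign_mul_self (∑ j, P.answers i x' r.1 j ⬝ᵥ r.2 j)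
    linear_combination (e - e') *
      (bitSign (u * ∑ j, P.answers i x' r.1 j ⬝ᵥ b i r.1 j) * halfAmp *
        (bitSign (u' * ∑ j, P.answers i x' r.1 j ⬝ᵥ b i r.1 j) * halfAmp))
  all_goals ring

theorem userDecoded_toQScheme (i : Fin n) (x : Bits n) (r : P.R × (Fin k → Bits a)) :
    (P.toQScheme b).userDecoded i x r =
      pureDensity (Pi.single (∑ j, P.answers i x r.1 j ⬝ᵥ b i r.1 j, P.maskedQuery b i r 0)
        (bitSign (∑ j, P.answers i x r.1 j ⬝ᵥ r.2 j))) := by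
  have h := shiftHadamard_mulVec (P.maskedQuery b i r 0) (P.branchShift b i r)
    (∑ j, P.answers i x r.1 j ⬝ᵥ r.2 j) (∑ j, P.answers i x r.1 j ⬝ᵥ b i r.1 j)
    (fun z => (P.toQScheme b).evolved i x r (z, fun _ => ()))
    (fun u y => P.evolved_toQScheme i x r u y _)
  rw [← h, pureDensity_mulVec, QScheme.userDecoded, userReceived_toQScheme]

theorem output_eq_of_prob_ne_zero (hP : P.IsPIR) (i : Fin n) (x : Bits n) (r : P.R)
    (hr : P.prob r ≠ 0) : P.output i r (P.answers i x r) = x i := by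
  have h := hP.recovery i x
  rw [← P.prob_sum, successProb] at h
  have h2 := (Finset.sum_eq_sum_iff_of_le (fun r _ => by
    split_ifs
    · exact le_rfl
    · exact P.prob_nonneg r)).1 h r (mem_univ r)
  by_contra hne
  rw [if_neg hne] at h2
  exact hr h2.symm

/-- With `u` and the coins fixed, the query registers are in a basis state, so tracing out `u`
leaves a diagonal matrix. Its entries depend on `i` only through the classical query distribution,
which is what user privacy needs. -/
theorem serverReceived_toQScheme (i : Fin n) (j : Fin k) (y y' : Bits (t + a)) :
    (P.toQScheme b).serverReceived i j y y' =
      if y = y' then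
        ((P.queryDist i j fun m => y (Fin.castAdd a m) : ℝ) : ℂ) *
          ∑ c : Fin k → Bits a, if (c j = fun m => y (Fin.natAdd t m)) then
            ((Fintype.card (Fin k → Bits a) : ℝ) : ℂ)⁻¹ else 0
      else 0 := by
  have h0 : (P.toQScheme b).serverReceived i j y y' =
      ∑ z : Fin k → Bits (t + a), if z j = y then
        ∑ u : ZMod 2, ∑ r : P.R × (Fin k → Bits a),
          ((P.prob r.1 * (Fintype.card (Fin k → Bits a) : ℝ)⁻¹ : ℝ) : ℂ) *
            ((if z = P.maskedQuery b i r u then halfAmp else 0) *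
              star (if Function.update z j y' = P.maskedQuery b i r u then halfAmp else 0))
      else 0 := by
    simp only [QScheme.serverReceived, marginal, traceLeft, QScheme.average, Matrix.sum_apply]
    rfl
  rw [h0]
  split_ifs with hy
  · subst hy
    have h1 : ∀ z : Fin k → Bits (t + a), (if z j = y then
        ∑ u : ZMod 2, ∑ r : P.R × (Fin k → Bits a),
          ((P.prob r.1 * (Fintype.card (Fin k → Bits a) : ℝ)⁻¹ : ℝ) : ℂ) *
            ((if z = P.maskedQuery b i r u then halfAmp else 0) *
              star (if Function.update z j y = P.maskedQuery b i r u then halfAmp else 0))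
        else 0) = ∑ u : ZMod 2, ∑ r : P.R × (Fin k → Bits a), if z = P.maskedQuery b i r u then
          (if z j = y then ((P.prob r.1 * (Fintype.card (Fin k → Bits a) : ℝ)⁻¹ : ℝ) : ℂ) / 2
            else 0) else 0 := by
      intro z
      split_ifs with h
      · subst h
        rw [Function.update_eq_self]
        refine sum_congr rfl fun u _ => sum_congr rfl fun r _ => ?_
        split_ifs
        · rw [star_halfAmp, halfAmp_mul_self, mul_one_div]
        · simp
      · simp
    have h2 : ∀ (u : ZMod 2) (r : P.R), (∑ c : Fin k → Bits a,
        if P.maskedQuery b i (r, c) u j = y then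
          ((P.prob r * (Fintype.card (Fin k → Bits a) : ℝ)⁻¹ : ℝ) : ℂ) / 2 else 0) =
        (if P.query i r j = fun m => y (Fin.castAdd a m) then (P.prob r : ℂ) else 0) *
          ((∑ c : Fin k → Bits a, if (c j = fun m => y (Fin.natAdd t m)) then
            ((Fintype.card (Fin k → Bits a) : ℝ) : ℂ)⁻¹ else 0) / 2) := by
      intro u r
      rw [← mul_div_assoc, mul_sum, sum_div]
      -- Translating the uniform masks absorbs `u • b`, although `b` is correlated with the query.
      refine Fintype.sum_equiv (Equiv.addRight (fun j => u • b i r j)) _ _ fun c => ?_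
      simp only [maskedQuery, bits_append_eq_iff, Equiv.coe_addRight, Pi.add_apply]
      by_cases h3 : P.query i r j = fun m => y (Fin.castAdd a m) <;>
        by_cases h4 : (c j + u • b i r j = fun m => y (Fin.natAdd t m)) <;>
        simp [h3, h4]
    simp only [h1]
    rw [sum_comm]
    simp only [sum_comm (s := (univ : Finset (Fin k → Bits (t + a)))), Finset.sum_ite_eq',
      mem_univ, if_true, Fintype.sum_prod_type, h2]
    rw [sum_bits, ← sum_mul, PIRScheme.queryDist, Complex.ofReal_sum]
    simp only [apply_ite Complex.ofReal, Complex.ofReal_zero]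
    ring
  · refine sum_eq_zero fun z _ => ?_
    split_ifs with h
    · refine sum_eq_zero fun u _ => sum_eq_zero fun r _ => ?_
      by_cases h1 : z = P.maskedQuery b i r u
      · rw [if_neg (c := Function.update z j y' = _), star_zero, mul_zero, mul_zero]
        intro h2
        have h3 := congrFun (h2.trans h1.symm) j
        rw [Function.update_self] at h3
        exact hy (h.symm.trans h3.symm)
      · rw [if_neg h1, zero_mul, mul_zero]
    · rfl

/-- The decoding unitary preserves the trace, and the decoded state is a basis state up to sign. -/
theorem trace_userReceived_toQScheme (i : Fin n) (x : Bits n) (r : P.R × (Fin k → Bits a)) :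
    ((P.toQScheme b).userReceived i x r).trace = 1 := by
  have h := trace_mul_cycle ((P.toQScheme b).decode i r : Matrix (P.toQScheme b).UserReg (P.toQScheme b).UserReg ℂ)
    ((P.toQScheme b).userReceived i x r)
    ((P.toQScheme b).decode i r : Matrix (P.toQScheme b).UserReg (P.toQScheme b).UserReg ℂ)ᴴ
  rw [← star_eq_conjTranspose, Unitary.coe_star_mul_self, one_mul] at h
  rw [← h, star_eq_conjTranspose]
  change ((P.toQScheme b).userDecoded i x r).trace = 1
  rw [userDecoded_toQScheme, pureDensity, trace_vecMulVec, single_dotProduct, Pi.star_apply,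
    Pi.single_eq_same, star_bitSign, bitSign_mul_self]

theorem isHonestUserQSPIR_toQScheme (hP : P.IsPIR)
    (hb : ∀ i r (ans : Fin k → Bits a), P.output i r ans = ∑ j, ans j ⬝ᵥ b i r j) :
    (P.toQScheme b).IsHonestUserQSPIR := by
  have hout : ∀ i x (r : P.R), P.prob r ≠ 0 → ∑ j, P.answers i x r j ⬝ᵥ b i r j = x i := by
    intro i x r hr
    rw [← hb, P.output_eq_of_prob_ne_zero hP i x r hr]
  have hrec : ∀ i (j : Fin k) i',
      (P.toQScheme b).serverReceived i j = (P.toQScheme b).serverReceived i' j := by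
    intro i j i'
    ext y y'
    rw [serverReceived_toQScheme, serverReceived_toQScheme, hP.user_privacy j i i']
  -- Classical recovery says nothing about coins of probability zero, but their blocks vanish.
  have hcoins : ∀ {α : Type} (ρ ρ' : P.R × (Fin k → Bits a) → Matrix α α ℂ),
      (∀ r, P.prob r.1 ≠ 0 → ρ r = ρ' r) →
      (P.toQScheme b).withCoins ρ = (P.toQScheme b).withCoins ρ' := by
    intro α ρ ρ' h
    unfold QScheme.withCoins
    congr 1
    funext r
    by_cases hr : P.prob r.1 = 0
    · have : (P.toQScheme b).prob r = 0 := by simp [hr]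
      rw [this]; simp
    · rw [h r hr]
  have hrcv : ∀ i (x x' : Bits n), x i = x' i → ∀ r : P.R × (Fin k → Bits a), P.prob r.1 ≠ 0 →
      (P.toQScheme b).userReceived i x r = (P.toQScheme b).userReceived i x' r := by
    intro i x x' hx r hr
    apply userReceived_toQScheme_eq
    rw [hout i x _ hr, hout i x' _ hr, hx]
  have hdec : ∀ i (x x' : Bits n), x i = x' i → ∀ r : P.R × (Fin k → Bits a), P.prob r.1 ≠ 0 →
      (P.toQScheme b).userDecoded i x r = (P.toQScheme b).userDecoded i x' r := by
    intro i x x' hx r hr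
    rw [QScheme.userDecoded, QScheme.userDecoded, hrcv i x x' hx r hr]
  refine ⟨fun i x => ?_, fun x j i i' => ?_, fun i x x' hx => ?_, fun i x w w' => ?_⟩
  · rw [← (P.toQScheme b).prob_sum]
    refine sum_congr rfl fun r _ => ?_
    by_cases hr : P.prob r.1 = 0
    · have : (P.toQScheme b).prob r = 0 := by simp [hr]
      rw [this, zero_mul]
    · rw [userDecoded_toQScheme, hout i x _ hr]
      refine (congrArg _ ?_).trans (mul_one _)
      rw [Finset.sum_eq_single (x i, P.maskedQuery b i r 0)]
      · rw [if_pos rfl, pureDensity, vecMulVec_apply, Pi.star_apply, Pi.single_eq_same,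
          star_bitSign, bitSign_mul_self, Complex.one_re]
      · intro z _ hz
        rw [pureDensity, vecMulVec_apply, Pi.single_eq_of_ne hz]
        simp
      · simp
  · simp only [QScheme.serverView, QScheme.serverFinal, QScheme.serverAnswered, hrec i j i']
  · simp only [QScheme.userView, Prod.mk.injEq, true_and]
    refine ⟨hcoins _ _ (hrcv i x x' hx), hcoins _ _ (hdec i x x' hx), hcoins _ _ fun r hr => ?_⟩
    ext z z'
    simp only [QScheme.userMeasured, hdec i x x' hx r hr]
  -- The servers' memories are one-dimensional, so each state is a single entry, equal to its trace
  -- 1.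
  · have e : w = fun _ => () := rfl
    have e' : w' = fun _ => () := rfl
    have h1 : ∀ j, (P.toQScheme b).serverFinal i x j (w j) (w' j) = 1 := fun j => by
      rw [← (P.toQScheme b).trace_serverFinal i x j]
      exact (Fintype.sum_unique (ι := Unit) _).symm
    simp only [h1, prod_const_one]
    have h2 : ((P.toQScheme b).serversJointFinal i x).trace = 1 := by
      rw [QScheme.serversJointFinal, trace_traceLeft]
      refine (P.toQScheme b).trace_average _ fun r => ?_
      rw [← P.trace_userReceived_toQScheme i x r, QScheme.userReceived]
      simp only [trace, diag_apply, traceRight, Fintype.sum_prod_type]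
    rw [← h2]
    exact (Fintype.sum_unique (ι := ∀ _ : Fin k, Unit)
      fun w => (P.toQScheme b).serversJointFinal i x w w).symm

end PIRScheme

/-! ### Classical schemes from group actions on the queries -/

/-- A scheme in which the query to each server is the uniformly random element `r` of a finite
group, shifted by an element determined by the index and the server. -/
theorem exists_xorLinear_of_shift {k n t a K : ℕ} (hk : K ≤ k) {G : Type} [AddCommGroup G]
    [Fintype G] (hG : Fintype.card G ≤ 2 ^ t) (shift : Fin n → ℕ → G)
    (ans : Bits n → G → Bits a) (b : Fin n → G → Bits a)
    (hrec : ∀ i x r, ∑ l ∈ range K, ans x (r + shift i l) ⬝ᵥ b i r = x i) :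
    ∃ P : PIRScheme k n t a, P.IsPIR ∧ P.IsXORLinear := by
  classical
  obtain ⟨enc⟩ : Nonempty (G ↪ Bits t) :=
    Function.Embedding.nonempty_of_card_le (by simpa [ZMod.card] using hG)
  have hc : (Fintype.card G : ℝ) ≠ 0 := by exact_mod_cast Fintype.card_ne_zero
  let P : PIRScheme k n t a :=
    { R := G
      prob := fun _ => (Fintype.card G : ℝ)⁻¹
      prob_nonneg := fun _ => by positivity
      prob_sum := by simp [hc]
      query := fun i r j => enc (r + shift i j)
      -- Surplus servers answer zero, so that a `K`-server scheme runs on any `k ≥ K` servers.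
      answer := fun j x q => if (j : ℕ) < K then ans x (Function.invFun enc q) else 0
      output := fun i r (v : Fin k → Bits a) => (∑ j, v j ⬝ᵥ b i r : ZMod 2) }
  have hout : ∀ i x (r : G), P.output i r (P.answers i x r) = x i := by
    intro i x r
    have h1 : P.output i r (P.answers i x r) =
        ∑ j : Fin k, if (j : ℕ) < K then ans x (r + shift i j) ⬝ᵥ b i r else 0 := by
      change ∑ j, P.answers i x r j ⬝ᵥ b i r = _
      refine Finset.sum_congr rfl fun j _ => ?_
      simp only [PIRScheme.answers, P]
      rw [Function.leftInverse_invFun enc.injective]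
      split_ifs <;> simp
    rw [h1, Fin.sum_univ_eq_sum_range
      (fun l => if l < K then ans x (r + shift i l) ⬝ᵥ b i r else 0) k, ← Finset.sum_filter,
      ← hrec i x r]
    congr 1
    ext l
    simp only [mem_filter, mem_range]
    omega
  have hdist : ∀ i j q, P.queryDist i j q =
      ∑ r : G, if enc r = q then (Fintype.card G : ℝ)⁻¹ else 0 := fun i j q =>
    -- A translate of a uniform group element is uniform, whence user privacy.
    Fintype.sum_equiv (Equiv.addRight (shift i j)) _ _ fun r => rfl
  refine ⟨P, ⟨fun i x => ?_, fun j i i' => ?_⟩, fun i r _ => b i r, fun _ _ _ => rfl⟩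
  · simp only [PIRScheme.successProb, hout, if_true]
    exact P.prob_sum
  · funext q
    rw [hdist, hdist]

/-- The two-server scheme in which the database is arranged in an `s × s` square. -/
theorem exists_xorLinear_square {k n s : ℕ} (hk : 2 ≤ k) (hn : n ≤ s * s) :
    ∃ P : PIRScheme k n s s, P.IsPIR ∧ P.IsXORLinear := by
  obtain ⟨ι⟩ : Nonempty (Fin n ↪ Fin s × Fin s) :=
    Function.Embedding.nonempty_of_card_le (by simpa using hn)
  refine exists_xorLinear_of_shift hk (G := Bits s) (by simp [ZMod.card])
    -- The two queries differ by the unit vector of the row of `i`. The answers list the parities of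
    -- each column over the queried rows, so their sum is that row.
    (fun i l => l • Pi.single (ι i).1 1)
    (fun x q c => ∑ i, if (ι i).2 = c then q (ι i).1 * x i else 0)
    (fun i _ => Pi.single (ι i).2 1) fun i x r => ?_
  simp only [dotProduct_single, mul_one, sum_range_succ, range_zero, sum_empty, zero_add,
    zero_smul, one_smul, add_zero, ← sum_add_distrib]
  rw [Finset.sum_eq_single i]
  · have : (r (ι i).1 : ZMod 2) + r (ι i).1 = 0 := CharTwo.add_self_eq_zero _
    simp only [if_true, Pi.add_apply, Pi.single_eq_same]
    linear_combination x i * this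
  · intro j _ hj
    have h2 : (r (ι j).1 * x j : ZMod 2) + r (ι j).1 * x j = 0 := CharTwo.add_self_eq_zero _
    split_ifs with h
    · have h1 : (ι j).1 ≠ (ι i).1 := fun h1 => hj (ι.injective (Prod.ext h1 h))
      simp [h1, h2]
    · simp
  · simp

/-! ### Matching vectors modulo 15 -/

/-- The indicator of `{0, 1, 6, 10}`, which sums to zero over every nontrivial coset. -/
def cosetTest (c : ZMod 15) : ZMod 2 := if c = 0 ∨ c = 1 ∨ c = 6 ∨ c = 10 then 1 else 0

/-- The multiples of `s ≠ 0` run through a nontrivial subgroup, whose cosets meet the test set in an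
even number of points. For `s = 0` the term is repeated 15 times, an odd number. -/
theorem sum_cosetTest (s c : ZMod 15) :
    ∑ l ∈ range 15, cosetTest (c + l * s) = if s = 0 then cosetTest c else 0 := by
  revert s c
  decide +kernel

/-- The fifteen-server scheme given by a matching family of vectors modulo 15. -/
theorem exists_xorLinear_of_matching {k n : ℕ} (hk : 15 ≤ k) {I : Type} [Fintype I]
    (u v : Fin n → I → ZMod 15) (huv : ∀ i j, u i ⬝ᵥ v j = 0 ↔ i = j) :
    ∃ P : PIRScheme k n (4 * Fintype.card I) 15, P.IsPIR ∧ P.IsXORLinear := by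
  classical
  refine exists_xorLinear_of_shift hk (G := I → ZMod 15) ?_
    (fun i l => (l : ZMod 15) • v i)
    (fun x q (c : ZMod 15) => ∑ j, if u j ⬝ᵥ q = c then x j else 0)
    -- Centring at `u i ⬝ᵥ r` makes the surviving coefficient, that of `x i`, equal to `cosetTest 0
    -- = 1`.
    (fun i r (c : ZMod 15) => cosetTest (c - u i ⬝ᵥ r)) fun i x r => ?_
  · rw [pow_mul, Fintype.card_fun, ZMod.card]
    exact Nat.pow_le_pow_left (by norm_num) _
  · have h1 : ∀ l : ℕ, ((fun c : ZMod 15 =>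
          ∑ j, if u j ⬝ᵥ (r + (l : ZMod 15) • v i) = c then x j else 0) ⬝ᵥ
          fun c : ZMod 15 => cosetTest (c - u i ⬝ᵥ r)) =
        ∑ j, x j * cosetTest ((u j ⬝ᵥ r - u i ⬝ᵥ r) + l * (u j ⬝ᵥ v i)) := by
      intro l
      change ∑ c : ZMod 15, (∑ j, if u j ⬝ᵥ (r + (l : ZMod 15) • v i) = c then x j else 0) *
        cosetTest (c - u i ⬝ᵥ r) = _
      simp only [sum_mul, ite_mul, zero_mul]
      rw [sum_comm]
      refine sum_congr rfl fun j _ => ?_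
      rw [Finset.sum_ite_eq, if_pos (mem_univ _), dotProduct_add, dotProduct_smul, smul_eq_mul,
        sub_add_eq_add_sub]
    refine (sum_congr rfl fun l _ => h1 l).trans ?_
    rw [sum_comm]
    simp only [← mul_sum, sum_cosetTest, huv, mul_ite, mul_zero]
    rw [Finset.sum_ite_eq' univ i]
    simp [cosetTest]

/-- A case of Lucas' theorem. -/
theorem choose_prime_pow_sub_one_mod {p : ℕ} (hp : p.Prime) (m s : ℕ) :
    s.choose (p ^ m - 1) % p = if p ^ m ∣ s + 1 then 1 else 0 := by
  have := Fact.mk hp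
  have hp2 := hp.two_le
  induction m generalizing s with
  | zero => simpa using Nat.mod_eq_of_lt hp.one_lt
  | succ m ih =>
    have hpm : 0 < p ^ m := Nat.pow_pos hp.pos
    -- In base `p` all digits of `p ^ (m + 1) - 1` are `p - 1`. Lucas' product is thus nonzero only
    -- if the last `m + 1` digits of `s` are all `p - 1`; the induction strips one digit at a time.
    have e0 : p ^ (m + 1) - 1 = (p - 1) + p * (p ^ m - 1) := by
      rw [pow_succ, Nat.mul_sub, mul_comm p]
      have : p * 1 ≤ p ^ m * p := by rw [mul_comm]; exact Nat.mul_le_mul hpm le_rfl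
      omega
    have e1 : (p ^ (m + 1) - 1) % p = p - 1 := by
      rw [e0, Nat.add_mul_mod_self_left, Nat.mod_eq_of_lt (by omega)]
    have e2 : (p ^ (m + 1) - 1) / p = p ^ m - 1 := by
      rw [e0, Nat.add_mul_div_left _ _ hp.pos, Nat.div_eq_of_lt (by omega), zero_add]
    have key := Choose.choose_modEq_choose_mod_mul_choose_div_nat
      (n := s) (k := p ^ (m + 1) - 1) (p := p)
    rw [e1, e2] at key
    have hs : s % p + p * (s / p) = s := Nat.mod_add_div s p
    have hlt := Nat.mod_lt s hp.pos
    by_cases h : s % p = p - 1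
    · have h3 : s + 1 = p * (s / p + 1) := by rw [mul_add]; omega
      rw [h, Nat.choose_self, one_mul] at key
      rw [key, ih, h3, pow_succ, mul_comm (p ^ m)]
      simp [Nat.mul_dvd_mul_iff_left hp.pos]
    · rw [Nat.choose_eq_zero_of_lt (n := s % p) (by omega), zero_mul] at key
      rw [key, if_neg, Nat.zero_mod]
      intro hd
      have h4 : p ∣ s + 1 := (Dvd.intro_left _ (pow_succ p m).symm).trans hd
      have h5 : p ∣ s % p + 1 := by
        have : s + 1 = p * (s / p) + (s % p + 1) := by omega
        rw [this] at h4
        exact (Nat.dvd_add_right (dvd_mul_right _ _)).1 h4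
      have := Nat.le_of_dvd (by omega) h5
      omega

/-- The coefficient 5 is `-1` modulo 3 and 0 modulo 5, while 9 is 0 modulo 3 and `-1` modulo 5. So
the vanishing modulo 3 and modulo 5 tests divisibility of `s + 1` by `3 ^ m` and by `5 ^ m`
separately. -/
theorem matching_polynomial_eq_zero_iff (m s : ℕ) (hs : s < 15 ^ m) :
    (1 : ZMod 15) + (5 * (s.choose (3 ^ m - 1) : ZMod 15) + 9 * (s.choose (5 ^ m - 1) : ZMod 15))
      = 0 ↔ s + 1 = 15 ^ m := by
  have h3 := choose_prime_pow_sub_one_mod Nat.prime_three m s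
  have h5 := choose_prime_pow_sub_one_mod Nat.prime_five m s
  have h : (1 : ZMod 15) + (5 * (s.choose (3 ^ m - 1) : ZMod 15) +
      9 * (s.choose (5 ^ m - 1) : ZMod 15)) =
      ((1 + (5 * s.choose (3 ^ m - 1) + 9 * s.choose (5 ^ m - 1)) : ℕ) : ZMod 15) := by
    push_cast; rfl
  rw [h, ZMod.natCast_eq_zero_iff]
  have hcop : Nat.Coprime (3 ^ m) (5 ^ m) := Nat.Coprime.pow _ _ (by norm_num)
  have h15 : 15 ^ m = 3 ^ m * 5 ^ m := by rw [← mul_pow]; rfl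
  constructor
  · intro hd
    have d3 : 3 ^ m ∣ s + 1 := by
      by_contra hc
      rw [if_neg hc] at h3
      omega
    have d5 : 5 ^ m ∣ s + 1 := by
      by_contra hc
      rw [if_neg hc] at h5
      omega
    have := Nat.le_of_dvd (by omega) (hcop.mul_dvd_of_dvd_of_dvd d3 d5)
    omega
  · intro he
    rw [if_pos (by rw [he, h15]; exact dvd_mul_right _ _)] at h3
    rw [if_pos (by rw [he, h15]; exact dvd_mul_left _ _)] at h5
    omega

/-- A binomial coefficient of the intersection size becomes an inner product, because a set lies in
both `A` and `B` exactly when it lies in `A ∩ B`. -/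
theorem sum_subset_indicator {X : Type} [Fintype X] [DecidableEq X] (d : ℕ) (A B : Finset X) :
    (∑ D : {D : Finset X // D.card = d},
      (if D.1 ⊆ A then (1 : ZMod 15) else 0) * (if D.1 ⊆ B then 1 else 0)) =
      ((A ∩ B).card.choose d : ZMod 15) := by
  rw [← card_powersetCard, ← Finset.sum_subtype (univ.filter fun D : Finset X => D.card = d)
    (by simp) (fun D => (if D ⊆ A then (1 : ZMod 15) else 0) * (if D ⊆ B then 1 else 0))]
  simp only [← ite_and, mul_ite, mul_one, mul_zero, ← Finset.sum_filter, sum_const,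
    nsmul_eq_mul, filter_filter]
  congr 2
  ext D
  simp only [mem_filter, mem_univ, true_and, mem_powersetCard, subset_inter_iff]
  tauto

/-- The graphs of the functions from `15 ^ m - 1` points to `g` points give a matching family. -/
theorem exists_xorLinear_graphs {k n m g : ℕ} (hk : 15 ≤ k) (hn : n ≤ g ^ (15 ^ m - 1)) :
    ∃ P : PIRScheme k n (4 * (1 + (((15 ^ m - 1) * g).choose (3 ^ m - 1) +
      ((15 ^ m - 1) * g).choose (5 ^ m - 1)))) 15, P.IsPIR ∧ P.IsXORLinear := by
  classical
  set w := 15 ^ m - 1 with hw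
  have hw1 : w + 1 = 15 ^ m := Nat.sub_add_cancel (Nat.pow_pos (by norm_num))
  obtain ⟨ι⟩ : Nonempty (Fin n ↪ (Fin w → Fin g)) :=
    Function.Embedding.nonempty_of_card_le (by simpa using hn)
  let A : Fin n → Finset (Fin w × Fin g) := fun i => univ.filter fun z => ι i z.1 = z.2
  have hA : ∀ i j, (A i ∩ A j).card = (univ.filter fun c => ι i c = ι j c).card := by
    intro i j
    refine (Finset.card_bij (fun c _ => (c, ι i c)) ?_ ?_ ?_).symm
    · intro c hc
      simp only [mem_filter, mem_univ, true_and] at hc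
      simp [A, hc]
    · intro c _ c' _ h
      exact (Prod.mk.inj h).1
    · rintro ⟨c, y⟩ hc
      simp only [A, mem_inter, mem_filter, mem_univ, true_and] at hc
      exact ⟨c, by simp [hc.1, hc.2], by simp [hc.1]⟩
  have hcard : ∀ i j, (A i ∩ A j).card + 1 = 15 ^ m ↔ i = j := by
    intro i j
    rw [hA, ← hw1, add_left_inj]
    have : (univ.filter fun c => ι i c = ι j c).card = w ↔
        (univ.filter fun c => ι i c = ι j c) = univ := by
      rw [← Finset.card_eq_iff_eq_univ, Fintype.card_fin]
    rw [this, Finset.filter_eq_self]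
    simp only [mem_univ, true_imp_iff]
    rw [← funext_iff, ι.injective.eq_iff]
  have hlt : ∀ i j, (A i ∩ A j).card < 15 ^ m := by
    intro i j
    rw [hA, ← hw1]
    exact Nat.lt_succ_of_le ((Finset.card_le_univ _).trans (by simp))
  let I (d : ℕ) : Type := {D : Finset (Fin w × Fin g) // D.card = d}
  let ind (d : ℕ) (i : Fin n) (D : I d) : ZMod 15 := if D.1 ⊆ A i then 1 else 0
  have hI : Fintype.card (Unit ⊕ I (3 ^ m - 1) ⊕ I (5 ^ m - 1)) =
      1 + ((w * g).choose (3 ^ m - 1) + (w * g).choose (5 ^ m - 1)) := by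
    simp only [Fintype.card_sum, Fintype.card_unit, I, Fintype.card_finset_len,
      Fintype.card_prod, Fintype.card_fin]
  rw [← hI]
  refine exists_xorLinear_of_matching hk
    -- The three blocks produce the three terms of the polynomial; the weights 5 and 9 are put on
    -- one side only.
    (fun i => Sum.elim (fun _ => 1) (Sum.elim (5 • ind _ i) (9 • ind _ i)))
    (fun i => Sum.elim (fun _ => 1) (Sum.elim (ind _ i) (ind _ i))) fun i j => ?_
  have h : ∀ d, ind d i ⬝ᵥ ind d j = ((A i ∩ A j).card.choose d : ZMod 15) := fun d =>
    sum_subset_indicator d (A i) (A j)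
  rw [sumElim_dotProduct_sumElim, sumElim_dotProduct_sumElim, smul_dotProduct, smul_dotProduct,
    h, h]
  simpa [dotProduct] using
    (matching_polynomial_eq_zero_iff m _ (hlt i j)).trans (hcard i j)

/-! ### Communication bounds -/

/-- With `w = 15 ^ m - 1` and `g = ⌈n ^ (1 / w)⌉ ≤ 2 n ^ (1 / w)`, each of the three summands is at
most `(w * g) ^ 5 ^ m`, which accounts for the constant `12 = 4 * 3`. -/
theorem exists_side_le_and_communication_le {n m k : ℕ} (hn : 1 ≤ n) (hm : 1 ≤ m) {ε : ℝ}
    (hε : (5 ^ m : ℝ) / (15 ^ m - 1 : ℕ) ≤ ε) :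
    ∃ g : ℕ, n ≤ g ^ (15 ^ m - 1) ∧
      ((k * (4 * (1 + (((15 ^ m - 1) * g).choose (3 ^ m - 1) +
        ((15 ^ m - 1) * g).choose (5 ^ m - 1))) + 15) : ℕ) : ℝ) ≤
      (k * (12 * (2 * (15 ^ m - 1 : ℕ)) ^ 5 ^ m + 15)) * (n : ℝ) ^ ε := by
  set w := 15 ^ m - 1 with hw
  have hw1 : 1 ≤ w := by
    have : 15 ^ 1 ≤ 15 ^ m := Nat.pow_le_pow_right (by norm_num) hm
    omega
  have hn1 : (1 : ℝ) ≤ n := by exact_mod_cast hn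
  have hw0 : (w : ℝ) ≠ 0 := by positivity
  set y : ℝ := (n : ℝ) ^ ((w : ℝ)⁻¹) with hy
  have hy1 : 1 ≤ y := Real.one_le_rpow hn1 (by positivity)
  have hg2 : (⌈y⌉₊ : ℝ) ≤ 2 * y := by linarith [Nat.ceil_lt_add_one (zero_le_one.trans hy1)]
  have hg1 : 1 ≤ ⌈y⌉₊ := Nat.one_le_ceil_iff.2 (by linarith)
  refine ⟨⌈y⌉₊, ?_, ?_⟩
  · have h1 : (n : ℝ) = y ^ w := by
      rw [hy, ← Real.rpow_natCast, ← Real.rpow_mul (by positivity), inv_mul_cancel₀ hw0,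
        Real.rpow_one]
    have h2 : (n : ℝ) ≤ (⌈y⌉₊ : ℝ) ^ w := by
      rw [h1]
      exact pow_le_pow_left₀ (by positivity) (Nat.le_ceil y) _
    exact_mod_cast h2
  · set z := w * ⌈y⌉₊
    have hz : 1 ≤ z := Nat.mul_pos hw1 hg1
    have h3 : z.choose (3 ^ m - 1) ≤ z ^ 5 ^ m := (Nat.choose_le_pow _ _).trans
      (Nat.pow_le_pow_right hz ((Nat.sub_le _ _).trans (Nat.pow_le_pow_left (by norm_num) m)))
    have h5 : z.choose (5 ^ m - 1) ≤ z ^ 5 ^ m := (Nat.choose_le_pow _ _).trans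
      (Nat.pow_le_pow_right hz (Nat.sub_le _ _))
    have h1 : 1 ≤ z ^ 5 ^ m := Nat.one_le_pow _ _ hz
    have hsum : k * (4 * (1 + (z.choose (3 ^ m - 1) + z.choose (5 ^ m - 1))) + 15) ≤
        k * (12 * z ^ 5 ^ m + 15) := Nat.mul_le_mul le_rfl (by omega)
    have hzr : (z : ℝ) ^ 5 ^ m ≤ (2 * w) ^ 5 ^ m * (n : ℝ) ^ ε := by
      have hz2 : (z : ℝ) ≤ 2 * w * y := by
        have : (z : ℝ) = w * ⌈y⌉₊ := Nat.cast_mul _ _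
        rw [this]
        nlinarith
      calc (z : ℝ) ^ 5 ^ m ≤ (2 * w * y) ^ 5 ^ m := pow_le_pow_left₀ (by positivity) hz2 _
        _ = (2 * w) ^ 5 ^ m * y ^ 5 ^ m := mul_pow _ _ _
        _ ≤ _ := by
          refine mul_le_mul_of_nonneg_left ?_ (by positivity)
          rw [hy, ← Real.rpow_natCast, ← Real.rpow_mul (by positivity)]
          refine Real.rpow_le_rpow_of_exponent_le hn1 (le_trans (le_of_eq ?_) hε)
          push_cast
          ring
    have hε0 : 0 ≤ ε := le_trans (by positivity) hε
    have hnε : 1 ≤ (n : ℝ) ^ ε := Real.one_le_rpow hn1 hε0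
    calc ((k * (4 * (1 + (z.choose (3 ^ m - 1) + z.choose (5 ^ m - 1))) + 15) : ℕ) : ℝ)
        ≤ ((k * (12 * z ^ 5 ^ m + 15) : ℕ) : ℝ) := by exact_mod_cast hsum
      _ = k * (12 * (z : ℝ) ^ 5 ^ m + 15) := by push_cast; ring
      _ ≤ k * (12 * ((2 * w) ^ 5 ^ m * (n : ℝ) ^ ε) + 15 * (n : ℝ) ^ ε) := by gcongr; linarith
      _ = _ := by ring

theorem exists_pow_div_le {ε : ℝ} (hε : 0 < ε) :
    ∃ m : ℕ, 1 ≤ m ∧ (5 ^ m : ℝ) / (15 ^ m - 1 : ℕ) ≤ ε := by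
  -- The ratio is essentially `3 ^ (-m)`; halving `ε` pays for the `- 1` in the denominator.
  obtain ⟨m, hm⟩ := exists_pow_lt_of_lt_one (half_pos hε) (by norm_num : (1 / 3 : ℝ) < 1)
  refine ⟨m + 1, by omega, ?_⟩
  have h15 : (2 : ℝ) ≤ 15 ^ (m + 1) := by
    rw [pow_succ]
    linarith [one_le_pow₀ (by norm_num : (1 : ℝ) ≤ 15) (n := m)]
  rw [Nat.cast_sub (Nat.one_le_pow _ _ (by norm_num))]
  push_cast
  rw [div_le_iff₀ (by linarith)]
  have h1 : (5 : ℝ) ^ (m + 1) = (1 / 3) ^ (m + 1) * 15 ^ (m + 1) := by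
    rw [← mul_pow]; norm_num
  have h2 : (1 / 3 : ℝ) ^ (m + 1) ≤ (1 / 3) ^ m :=
    pow_le_pow_of_le_one (by norm_num) (by norm_num) (by omega)
  rw [h1]
  nlinarith

/-- Fifteen servers suffice for an arbitrarily small exponent. -/
theorem exists_xorLinear_exponent_le {k : ℕ} (hk : 15 ≤ k) {ε : ℝ} (hε : 0 < ε) :
    ∃ C : ℝ, ∀ n : ℕ, 1 ≤ n → ∃ (t a : ℕ) (P : PIRScheme k n t a),
      P.IsPIR ∧ P.IsXORLinear ∧ (P.communication : ℝ) ≤ C * (n : ℝ) ^ ε := by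
  obtain ⟨m, hm, hmε⟩ := exists_pow_div_le hε
  refine ⟨k * (12 * (2 * (15 ^ m - 1 : ℕ)) ^ 5 ^ m + 15), fun n hn => ?_⟩
  obtain ⟨g, hg, hc⟩ := exists_side_le_and_communication_le (k := k) hn hm hmε
  obtain ⟨P, hP, hb⟩ := exists_xorLinear_graphs hk hg
  exact ⟨_, _, P, hP, hb, hc⟩

theorem exists_xorLinear_exponent_half {k : ℕ} (hk : 2 ≤ k) :
    ∃ C : ℝ, ∀ n : ℕ, 1 ≤ n → ∃ (t a : ℕ) (P : PIRScheme k n t a),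
      P.IsPIR ∧ P.IsXORLinear ∧ (P.communication : ℝ) ≤ C * (n : ℝ) ^ (1 / 2 : ℝ) := by
  -- The communication is `2 * k * (n.sqrt + 1)`, and both `n.sqrt` and 1 are at most `√n`.
  refine ⟨4 * k, fun n hn => ?_⟩
  obtain ⟨P, hP, hb⟩ := exists_xorLinear_square hk (s := n.sqrt + 1) (n := n)
    (Nat.lt_succ_sqrt n).le
  refine ⟨_, _, P, hP, hb, ?_⟩
  have h1 : (n.sqrt : ℝ) ≤ (n : ℝ) ^ (1 / 2 : ℝ) := by
    rw [← Real.sqrt_eq_rpow]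
    exact Real.nat_sqrt_le_real_sqrt
  have h2 : (1 : ℝ) ≤ (n : ℝ) ^ (1 / 2 : ℝ) :=
    Real.one_le_rpow (by exact_mod_cast hn) (by norm_num)
  have hk0 : (0 : ℝ) ≤ k := Nat.cast_nonneg k
  rw [PIRScheme.communication]
  push_cast
  nlinarith [mul_le_mul_of_nonneg_left h1 hk0, mul_le_mul_of_nonneg_left h2 hk0]

/-! ### Passage to quantum schemes and choice of the exponent. -/

theorem exists_honestUserQSPIR_of_xorLinear {k n t a : ℕ} (P : PIRScheme k n t a) (hP : P.IsPIR)
    (hb : P.IsXORLinear) : ∃ S : QScheme k n (t + a) (t + a),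
      S.IsHonestUserQSPIR ∧ S.communication = 2 * P.communication := by
  obtain ⟨b, hb⟩ := hb
  refine ⟨P.toQScheme b, P.isHonestUserQSPIR_toQScheme hP hb, ?_⟩
  rw [QScheme.communication, PIRScheme.communication]
  ring

/-- The exponent of the communication as a function of the number of servers. -/
noncomputable def commExponent (k : ℕ) : ℝ :=
  -- From fifteen servers on every positive exponent is attainable, so the target bound itself
  -- serves; only its positivity and being below 1 remain to be checked.
  if k < 15 then 1 / 2 else Real.log (Real.log k) / (k * Real.log k)

theorem commExponent_pos_and_lt_one {k : ℕ} (hk : 15 ≤ k) :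
    0 < commExponent k ∧ commExponent k < 1 := by
  have hk' : (15 : ℝ) ≤ k := by exact_mod_cast hk
  have h1 : 1 < Real.log k := by
    rw [Real.lt_log_iff_exp_lt (by linarith)]
    linarith [Real.exp_one_lt_d9]
  have h2 : 0 < Real.log (Real.log k) := Real.log_pos h1
  have h3 : Real.log (Real.log k) < Real.log k := by
    linarith [Real.log_le_sub_one_of_pos (zero_lt_one.trans h1)]
  rw [commExponent, if_neg (by omega)]
  refine ⟨by positivity, ?_⟩
  rw [div_lt_one (by positivity)]
  nlinarith

theorem mainTheorem1 :
    (∀ (k n t a : ℕ) (P : PIRScheme k n t a), P.IsPIR → P.IsXORLinear →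
      ∃ S : QScheme k n (t + a) (t + a),
        S.IsHonestUserQSPIR ∧ S.communication = 2 * P.communication) ∧
    (∃ e : ℕ → ℝ,
      e =O[Filter.atTop] (fun k : ℕ => Real.log (Real.log k) / (k * Real.log k)) ∧
      ∀ k : ℕ, 2 ≤ k → e k < 1 ∧
        ∃ C : ℝ, ∀ n : ℕ, 1 ≤ n → ∃ (t a : ℕ) (S : QScheme k n t a),
          S.IsHonestUserQSPIR ∧ (S.communication : ℝ) ≤ C * (n : ℝ) ^ e k) := by
  refine ⟨fun k n t a P hP hb => exists_honestUserQSPIR_of_xorLinear P hP hb,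
    commExponent, ?_, fun k hk => ?_⟩
  · refine Filter.EventuallyEq.isBigO ?_
    filter_upwards [Filter.eventually_ge_atTop 15] with k hk
    rw [commExponent, if_neg (by omega)]
  · have h : commExponent k < 1 ∧ ∃ C : ℝ, ∀ n : ℕ, 1 ≤ n →
        ∃ (t a : ℕ) (P : PIRScheme k n t a),
          P.IsPIR ∧ P.IsXORLinear ∧ (P.communication : ℝ) ≤ C * (n : ℝ) ^ commExponent k := by
      by_cases h15 : k < 15
      · rw [commExponent, if_pos h15]
        exact ⟨by norm_num, exists_xorLinear_exponent_half hk⟩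
      · have h := commExponent_pos_and_lt_one (not_lt.1 h15)
        exact ⟨h.2, exists_xorLinear_exponent_le (not_lt.1 h15) h.1⟩
    obtain ⟨h1, C, hC⟩ := h
    refine ⟨h1, 2 * C, fun n hn => ?_⟩
    obtain ⟨t, a, P, hP, hb, hc⟩ := hC n hn
    obtain ⟨S, hS, hSc⟩ := exists_honestUserQSPIR_of_xorLinear P hP hb
    refine ⟨_, _, S, hS, ?_⟩
    rw [hSc]
    push_cast
    linarith
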